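/- Let $\Sigma$ be a finite alphabet and $k\ge 1$. Let $\mathcal P(\Sigma^k)$ be the set of probability measures on $\Sigma^k$, viewed as a subset of $\mathbb R^{\Sigma^k}$, and let $\mathcal P_{\mathrm{si}}(\Sigma^k)$ be the set of $\eta\in\mathcal P(\Sigma^k)$ that are shift-invariant, i.e. $\sum_{a\in\Sigma}\eta(a\phi)=\sum_{a\in\Sigma}\eta(\phi a)$ for all $\phi\in\Sigma^{k-1}$. For a word $\omega$ over $\Sigma$ of length $|\omega|\ge k$ let $\mathrm{fr}^k_\omega\in\mathcal P(\Sigma^k)$ be its empirical $k$-tuple distribution, $$\mathrm{fr}^k_\omega(\beta)=\frac{\left|\{(\alpha,\gamma)\in\Sigma^*\times\Sigma^* : \alpha\beta\gamma=\omega\}\right|}{|\omega|-k+1}\qquad(\beta\in\Sigma^k).$$ A semiconstrained system is a set $\Gamma\subseteq\mathcal P(\Sigma^k)$; its set of admissible words is $\mathcal B(\Gamma)=\{\omega\in\Sigma^* : |\omega|\ge k,\ \mathrm{fr}^k_\omega\in\Gamma\}$. It is called fat if the closure of the interior of $\Gamma\cap\mathcal P_{\mathrm{si}}(\Sigma^k)$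 equals the closure of $\Gamma\cap\mathcal P_{\mathrm{si}}(\Sigma^k)$, where closure and interior are taken relative to $\mathcal P_{\mathrm{si}}(\Sigma^k)$. The capacity of $S\subseteq\Sigma^*$ is $$\mathrm{cap}(S)=\limsup_{n\to\infty}\frac1n\log_2|S\cap\Sigma^n|\in[-\infty,\infty),\qquad \log_2 0=-\infty.$$ For $q\ge1$ and a finite directed graph $G$ (parallel edges allowed) whose edges are labelled by words in $\Sigma^q$, let $\mathcal L(G)\subseteq\Sigma^*$ be the set of labels of all finite non-empty directed paths in $G$, the label of a path being the concatenation of the labels of its edges. Define $$\mathrm{cap}^{\subseteq}(\Gamma)=\sup\{\mathrm{cap}(\mathcal L(G)) : \mathcal L(G)\subseteq\mathcal B(\Gamma)\},$$ the supremum being taken in $[-\infty,\infty]$ over all $q\ge1$ and all such graphs $G$. Let $\Gamma\subseteq\mathcal P(\Sigma^k)$ be closed, convex and fat. Then $$\mathrm{cap}^{\subseteq}(\Gamma)=\mathrm{cap}(\mathcal B(\Gamma)).$$ -/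

import Mathlib

namespace Semiconstrained

/-- The word `a φ` of length `k`, for a letter `a` and a word `φ` of length `k - 1` (for `1 ≤ k`). -/
def prependLetter {α : Type*} {k : ℕ} (a : α) (φ : Fin (k - 1) → α) : Fin k → α :=
  fun i => if h : (i : ℕ) = 0 then a else φ ⟨(i : ℕ) - 1, by have := i.isLt; omega⟩

/-- The word `φ a` of length `k`, for a letter `a` and a word `φ` of length `k - 1` (for `1 ≤ k`). -/
def appendLetter {α : Type*} {k : ℕ} (φ : Fin (k - 1) → α) (a : α) : Fin k → α :=
  fun i => if h : (i : ℕ) < k - 1 then φ ⟨(i : ℕ), h⟩ else a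

/-- The set of all probability measures on the words of length `k` over the finite alphabet `α`,
identified with the probability vectors indexed by these words. -/
def probMeasures (α : Type*) [Fintype α] (k : ℕ) : Set ((Fin k → α) → ℝ) :=
  stdSimplex ℝ (Fin k → α)

/-- The shift-invariant probability measures on the words of length `k`. -/
def shiftInvariantMeasures (α : Type*) [Fintype α] (k : ℕ) : Set ((Fin k → α) → ℝ) :=
  {η | η ∈ probMeasures α k ∧
    ∀ φ : Fin (k - 1) → α, ∑ a, η (prependLetter a φ) = ∑ a, η (appendLetter φ a)}

/-- The empirical frequency of the word `β` of length `k` among the subwords of length `k`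
of `ω` (meaningful when `k ≤ ω.length`). -/
noncomputable def freq {α : Type*} (k : ℕ) (ω : List α) (β : Fin k → α) : ℝ :=
  (Set.ncard {p : List α × List α | p.1 ++ List.ofFn β ++ p.2 = ω} : ℝ) /
    ((ω.length : ℝ) - (k : ℝ) + 1)

/-- The admissible words of the semiconstrained system `Γ`. -/
def admissible {α : Type*} {k : ℕ} (Γ : Set ((Fin k → α) → ℝ)) : Set (List α) :=
  {ω | k ≤ ω.length ∧ freq k ω ∈ Γ}

/-- Base-two logarithm of a natural number, with `log₂ 0 = -∞`. -/
noncomputable def elog2 (N : ℕ) : EReal :=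
  if N = 0 then ⊥ else ((Real.logb 2 (N : ℝ) : ℝ) : EReal)

/-- The capacity of a set of words, an extended real number (it is `-∞` for a finite set). -/
noncomputable def capacity {α : Type*} (S : Set (List α)) : EReal :=
  Filter.limsup
    (fun n : ℕ => (((1 / (n : ℝ) : ℝ)) : EReal) * elog2 (Set.ncard {ω ∈ S | ω.length = n}))
    Filter.atTop

/-- `Γ` is fat: inside the space of shift-invariant measures (with its subspace topology), the
closure of the interior of the trace of `Γ` equals the closure of that trace. -/
def IsFat {α : Type*} [Fintype α] {k : ℕ} (Γ : Set ((Fin k → α) → ℝ)) : Prop :=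
  closure (interior {η : shiftInvariantMeasures α k | (η : (Fin k → α) → ℝ) ∈ Γ}) =
    closure {η : shiftInvariantMeasures α k | (η : (Fin k → α) → ℝ) ∈ Γ}

/-- A finite directed graph, parallel edges and loops allowed, whose edges are labelled by
words of length `q`. -/
structure LabeledGraph (α : Type*) (q : ℕ) where
  /-- The vertices. -/
  V : Type
  /-- The edges. -/
  E : Type
  finite_V : Finite V
  finite_E : Finite E
  /-- The initial vertex of an edge. -/
  src : E → V
  /-- The terminal vertex of an edge. -/
  tgt : E → V
  /-- The label of an edge. -/
  label : E → (Fin q → α)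

/-- The language presented by `G`: the labels of all finite nonempty directed paths. -/
def LabeledGraph.language {α : Type*} {q : ℕ} (G : LabeledGraph α q) : Set (List α) :=
  {ω | ∃ p : List G.E, p ≠ [] ∧ p.IsChain (fun e f => G.tgt e = G.src f) ∧
    ω = p.flatMap (fun e => List.ofFn (G.label e))}

/-- The fully constrained contained capacity of `Γ`: the supremum of the capacities of the
languages contained in the admissible words of `Γ` that are presented by some finite graph with
labels of some positive length `q`. -/
noncomputable def containedCapacity {α : Type*} {k : ℕ} (Γ : Set ((Fin k → α) → ℝ)) : EReal :=
  sSup {c : EReal | ∃ q : ℕ, 1 ≤ q ∧ ∃ G : LabeledGraph α q,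
    G.language ⊆ admissible Γ ∧ c = capacity G.language}

end Semiconstrained

namespace Semiconstrained

/-! The inequality `≤` is monotonicity of capacity. For `≥`, write k = m + 1 and fix a word z of
length m. A loop at z is a word u such that zu ends in z. A window of length m + 1 sees only m
letters of the past, so window counts read after z add up when loops are concatenated
(`loopCount_append`). The frequency vector of z followed by several loops is thus a convex
combination of those of the single loops. By convexity of Γ, a one-vertex graph whose loops all have
frequencies in Γ presents only admissible words (`bouquet_language_subset`).

To make such loops out of almost all the entropy, close each admissible l of length n into the loop
lz. This changes the counts by O(m), but may push the frequency slightly out of Γ. The repair is to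
append R ≈ n/s copies of a fixed loop v whose frequency is interior to Γ relative to the
shift-invariant measures (`exists_threshold`). It works because frequencies of long admissible words
lie uniformly close to Γ ∩ P_si (`exists_near_shiftInvariant`). The labels have common length n +
O(n/s) + O(1) and are as many as the admissible words of length n; letting s grow loses no rate.

The loop v exists because fatness provides a relative interior point and loop frequencies are dense
in P_si (`mem_closure_loopFreqs`). Density is proved by Hahn–Banach: the closure of the loop
frequencies is convex, and dynamic programming finds, for any linear functional, words scoring
essentially as well as a given shift-invariant measure. -/

open Classical in
/-- The number of occurrences of `w` as a contiguous subword, `w` being nonempty. -/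
noncomputable def windowCount {α : Type*} (w : List α) : List α → ℕ
  | [] => 0
  | a :: l => (if w <+: a :: l then 1 else 0) + windowCount w l

/-! ### Occurrences of a word as a contiguous subword -/

section Counting

variable {α : Type*}

theorem finite_occurrences (w l : List α) :
    {p : List α × List α | p.1 ++ w ++ p.2 = l}.Finite := by
  refine ((l.inits.finite_toSet).prod (l.tails.finite_toSet)).subset ?_
  rintro ⟨x, y⟩ h
  simp only [Set.mem_ofPred_eq] at h
  subst h
  simp only [Set.mem_prod, Set.mem_ofPred_eq, List.mem_inits, List.mem_tails]
  exact ⟨by simp [List.append_assoc], List.suffix_append _ _⟩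

open Classical in
theorem ncard_occurrences {w : List α} (hw : w ≠ []) (l : List α) :
    Set.ncard {p : List α × List α | p.1 ++ w ++ p.2 = l} = windowCount w l := by
  induction l with
  | nil =>
    have : {p : List α × List α | p.1 ++ w ++ p.2 = []} = ∅ := by
      ext p
      simp [hw]
    rw [this, Set.ncard_empty, windowCount]
  | cons a l ih =>
    have hinj : Function.Injective (fun p : List α × List α => (a :: p.1, p.2)) := by
      rintro ⟨x, y⟩ ⟨x', y'⟩ h
      simpa using h
    have hsplit : {p : List α × List α | p.1 ++ w ++ p.2 = a :: l} =
        {p : List α × List α | p.1 = [] ∧ w ++ p.2 = a :: l} ∪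
          (fun p : List α × List α => (a :: p.1, p.2)) '' {p | p.1 ++ w ++ p.2 = l} := by
      ext ⟨x, y⟩
      cases x with
      | nil => simp
      | cons b x =>
        simp only [Set.mem_ofPred_eq, List.cons_append, List.cons.injEq, Set.mem_union,
          Set.mem_image, Prod.mk.injEq, Prod.exists, reduceCtorEq, false_and, false_or]
        constructor
        · rintro ⟨rfl, h⟩
          exact ⟨x, y, h, ⟨rfl, rfl⟩, rfl⟩
        · rintro ⟨x', y', h, ⟨rfl, rfl⟩, rfl⟩
          exact ⟨rfl, h⟩
    have hfst : Set.ncard {p : List α × List α | p.1 = [] ∧ w ++ p.2 = a :: l} =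
        if w <+: a :: l then 1 else 0 := by
      split_ifs with h
      · obtain ⟨t, ht⟩ := h
        rw [Set.ncard_eq_one]
        refine ⟨([], t), ?_⟩
        ext ⟨x, y⟩
        simp only [Set.mem_ofPred_eq, Set.mem_singleton_iff, Prod.mk.injEq]
        rw [← ht, List.append_cancel_left_eq]
      · have : {p : List α × List α | p.1 = [] ∧ w ++ p.2 = a :: l} = ∅ := by
          ext ⟨x, y⟩
          simp only [Set.mem_ofPred_eq, Set.mem_empty_iff_false, iff_false, not_and]
          exact fun _ hy => h ⟨y, hy⟩
        simp [this]
    have hfin := finite_occurrences w (a :: l)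
    rw [hsplit] at hfin ⊢
    rw [Set.ncard_union_eq ?_ (hfin.subset Set.subset_union_left)
      (hfin.subset Set.subset_union_right), hfst, Set.ncard_image_of_injective _ hinj, ih,
      windowCount]
    rw [Set.disjoint_left]
    rintro _ ⟨h, -⟩ ⟨p, -, rfl⟩
    simp at h

theorem windowCount_le (w l : List α) : windowCount w l ≤ l.length + 1 - w.length := by
  induction l with
  | nil => simp [windowCount]
  | cons a l ih =>
    rw [windowCount]
    split_ifs with h
    · have := h.length_le
      simp only [List.length_cons] at this ⊢
      omega
    · simp only [List.length_cons]
      omega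

theorem windowCount_eq_zero {w l : List α} (h : l.length < w.length) : windowCount w l = 0 := by
  have := windowCount_le w l
  omega

theorem prefix_append_iff {w l : List α} (t : List α) (h : w.length ≤ l.length) :
    w <+: l ++ t ↔ w <+: l :=
  ⟨fun h' => List.prefix_of_prefix_length_le h' (List.prefix_append l t) h,
    fun h' => h'.trans (List.prefix_append l t)⟩

/-- The overlap z is one letter too short to contain w, so each occurrence lies in exactly one of
the two overlapping pieces. -/
theorem windowCount_overlap {w z : List α} (h : w.length = z.length + 1) (x y : List α) :
    windowCount w (x ++ z ++ y) = windowCount w (x ++ z) + windowCount w (z ++ y) := by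
  induction x with
  | nil => simp [windowCount_eq_zero (l := z) (w := w) (by omega)]
  | cons a x ih =>
    have : w <+: a :: (x ++ z ++ y) ↔ w <+: a :: (x ++ z) :=
      prefix_append_iff (l := a :: (x ++ z)) y (by simp; omega)
    simp only [List.cons_append, windowCount, ih, add_assoc]
    by_cases hp : w <+: a :: (x ++ z)
    · rw [if_pos hp, if_pos (by simpa using this.2 hp)]
    · rw [if_neg hp, if_neg (by simpa using fun h' => hp (this.1 h'))]

open Classical in
theorem sum_prefix_eq_one [Fintype α] {j : ℕ} {l : List α} (h : j ≤ l.length) :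
    (∑ β : Fin j → α, if List.ofFn β <+: l then 1 else 0) = 1 := by
  have key : ∀ β : Fin j → α, List.ofFn β <+: l ↔ β = fun i => l[i] := by
    intro β
    constructor
    · intro hp
      ext i
      have := hp.getElem (i := i) (by simp)
      simpa using this
    · rintro rfl
      have : List.ofFn (fun i : Fin j => l[i]) = l.take j := by
        apply List.ext_getElem
        · simp [h]
        · intro i h1 h2
          simp
      rw [this]
      exact List.take_prefix j l
  simp [key]

theorem sum_windowCount [Fintype α] (m : ℕ) (l : List α) :
    ∑ β : Fin (m + 1) → α, windowCount (List.ofFn β) l = l.length - m := by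
  induction l with
  | nil => simp [windowCount]
  | cons a l ih =>
    simp only [windowCount, Finset.sum_add_distrib, ih, List.length_cons]
    by_cases h : m + 1 ≤ (a :: l).length
    · rw [sum_prefix_eq_one h]
      simp only [List.length_cons] at h
      omega
    · have : ∀ β : Fin (m + 1) → α, ¬ List.ofFn β <+: a :: l := by
        intro β hp
        have := hp.length_le
        rw [List.length_ofFn] at this
        omega
      simp only [this, if_false, Finset.sum_const_zero]
      simp only [List.length_cons] at h
      omega

open Classical in
theorem sum_prefix_append_singleton [Fintype α] {w l : List α} (h : w.length < l.length) :
    (∑ a, if w ++ [a] <+: l then 1 else 0) = if w <+: l then 1 else 0 := by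
  split_ifs with hp
  · obtain ⟨t, rfl⟩ := hp
    cases t with
    | nil => simp at h
    | cons b t =>
      simp [List.prefix_append_right_inj]
  · have : ∀ a, ¬ w ++ [a] <+: l := fun a ha => hp ((List.prefix_append w [a]).trans ha)
    simp [this]

open Classical in
theorem sum_prefix_cons [Fintype α] (w l : List α) (b : α) :
    (∑ a, if a :: w <+: b :: l then 1 else 0) = if w <+: l then 1 else 0 := by
  simp only [List.cons_prefix_cons]
  split_ifs with h <;> simp [h]

open Classical in
-- Both sides count occurrences of w in l: each one is followed by a letter unless it is a suffix,
-- and preceded by a letter unless it is a prefix. This is approximate shift-invariance of empirical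
-- counts.
theorem windowCount_flow [Fintype α] {w l : List α} (h : w.length ≤ l.length) :
    (∑ a, windowCount (w ++ [a]) l) + (if w <:+ l then 1 else 0) =
      (∑ a, windowCount (a :: w) l) + (if w <+: l then 1 else 0) := by
  induction l with
  | nil =>
    have : w = [] := by simpa using h
    subst this
    simp [windowCount]
  | cons b l ih =>
    rcases Nat.lt_or_ge l.length w.length with hl | hl
    · have h1 : ∀ a, windowCount (w ++ [a]) (b :: l) = 0 := fun a =>
        windowCount_eq_zero (by simp; omega)
      have h2 : ∀ a, windowCount (a :: w) (b :: l) = 0 := fun a =>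
        windowCount_eq_zero (by simp; omega)
      have hlen : w.length = (b :: l).length := by
        simp only [List.length_cons] at h ⊢
        omega
      have h3 : w <:+ b :: l ↔ w = b :: l :=
        ⟨fun hs => hs.eq_of_length hlen, fun hs => hs ▸ List.suffix_refl _⟩
      have h4 : w <+: b :: l ↔ w = b :: l :=
        ⟨fun hs => hs.eq_of_length hlen, fun hs => hs ▸ List.prefix_refl _⟩
      simp only [h1, h2, h3, h4]
    · have h3 : w <:+ b :: l ↔ w <:+ l := by
        rw [List.suffix_cons_iff]
        refine or_iff_right ?_
        rintro rfl
        simp at hl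
      have hi := ih hl
      simp only [windowCount, Finset.sum_add_distrib, h3, sum_prefix_cons,
        sum_prefix_append_singleton (show w.length < (b :: l).length by simp; omega)]
      omega

end Counting

/-! ### Loops at a fixed word and additivity of their counts -/

section Loops

variable {α : Type*} {m : ℕ}

/-- The numbers of occurrences in `l` of all the words of length `m + 1`. -/
noncomputable def countVec (m : ℕ) (l : List α) : (Fin (m + 1) → α) → ℝ :=
  fun β => (windowCount (List.ofFn β) l : ℝ)

theorem freq_eq (l : List α) :
    freq (m + 1) l = ((l.length : ℝ) - m)⁻¹ • countVec m l := by
  ext β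
  have hne : List.ofFn β ≠ [] := by simp
  rw [freq, ncard_occurrences hne, Pi.smul_apply, countVec, smul_eq_mul, inv_mul_eq_div]
  congr 1
  push_cast
  ring

theorem countVec_nonneg (l : List α) (β : Fin (m + 1) → α) : 0 ≤ countVec m l β :=
  Nat.cast_nonneg _

theorem countVec_le {l : List α} (h : m ≤ l.length) (β : Fin (m + 1) → α) :
    countVec m l β ≤ (l.length : ℝ) - m := by
  have := windowCount_le (List.ofFn β) l
  rw [List.length_ofFn, Nat.add_sub_add_right] at this
  rw [countVec, ← Nat.cast_sub h]
  exact_mod_cast this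

theorem norm_countVec_le [Fintype α] {l : List α} (h : m ≤ l.length) :
    ‖countVec m l‖ ≤ (l.length : ℝ) - m := by
  have h0 : (0 : ℝ) ≤ (l.length : ℝ) - m := by
    rw [sub_nonneg]
    exact_mod_cast h
  rw [pi_norm_le_iff_of_nonneg h0]
  intro β
  rw [Real.norm_of_nonneg (countVec_nonneg l β)]
  exact countVec_le h β

theorem sum_countVec [Fintype α] {l : List α} (h : m ≤ l.length) :
    ∑ β, countVec m l β = (l.length : ℝ) - m := by
  rw [← Nat.cast_sub h, ← sum_windowCount m l]
  push_cast
  rfl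

theorem countVec_overlap {z : List α} (hz : z.length = m) (x y : List α) :
    countVec m (x ++ z ++ y) = countVec m (x ++ z) + countVec m (z ++ y) := by
  ext β
  simp only [countVec, Pi.add_apply]
  rw [windowCount_overlap (by simp [hz]), Nat.cast_add]

theorem ofFn_prependLetter (a : α) (φ : Fin m → α) :
    List.ofFn (prependLetter (k := m + 1) a φ) = a :: List.ofFn φ := by
  rw [List.ofFn_succ]
  simp [prependLetter]

theorem ofFn_appendLetter (a : α) (φ : Fin m → α) :
    List.ofFn (appendLetter (k := m + 1) φ a) = List.ofFn φ ++ [a] := by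
  rw [List.ofFn_succ_last]
  simp [appendLetter]

open Classical in
theorem countVec_flow [Fintype α] {l : List α} (h : m ≤ l.length) (φ : Fin m → α) :
    (∑ a, countVec m l (prependLetter a φ)) - ∑ a, countVec m l (appendLetter φ a) =
      (if List.ofFn φ <:+ l then 1 else 0) - (if List.ofFn φ <+: l then 1 else 0) := by
  have := windowCount_flow (w := List.ofFn φ) (l := l) (by simpa using h)
  simp only [countVec, ofFn_prependLetter, ofFn_appendLetter]
  have h2 := congrArg (Nat.cast (R := ℝ)) this
  push_cast at h2
  linarith

theorem abs_countVec_flow_le [Fintype α] {l : List α} (h : m ≤ l.length) (φ : Fin m → α) :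
    |(∑ a, countVec m l (prependLetter a φ)) - ∑ a, countVec m l (appendLetter φ a)| ≤ 1 := by
  classical
  rw [countVec_flow h]
  split_ifs <;> simp

/-- Appending `u` to `z` gives a word that ends in `z`. -/
def IsLoop (z u : List α) : Prop := z <:+ z ++ u

/-- The window counts picked up while reading `u` after `z`. -/
noncomputable def loopCount (m : ℕ) (z u : List α) : (Fin (m + 1) → α) → ℝ :=
  countVec m (z ++ u)

theorem isLoop_append_self (z u : List α) : IsLoop z (u ++ z) := by
  rw [IsLoop, ← List.append_assoc]
  exact List.suffix_append _ _

theorem IsLoop.append {z u v : List α} (hu : IsLoop z u) (hv : IsLoop z v) :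
    IsLoop z (u ++ v) := by
  obtain ⟨t, ht⟩ := hu
  rw [IsLoop, ← List.append_assoc, ← ht, List.append_assoc]
  exact hv.trans (List.suffix_append _ _)

theorem IsLoop.prepend_self {z u : List α} (hu : IsLoop z u) : IsLoop z (z ++ u) :=
  hu.trans (List.suffix_append _ _)

theorem loopCount_append {z u : List α} (hz : z.length = m) (hu : IsLoop z u) (v : List α) :
    loopCount m z (u ++ v) = loopCount m z u + loopCount m z v := by
  obtain ⟨t, ht⟩ := hu
  rw [loopCount, ← List.append_assoc, ← ht, countVec_overlap hz, loopCount, loopCount, ht]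

theorem loopCount_nil {z : List α} (hz : z.length = m) : loopCount m z [] = 0 := by
  ext β
  rw [loopCount, countVec, windowCount_eq_zero (by simp [hz])]
  simp

/-- The concatenation of `n` copies of `u`. -/
def wordPow (u : List α) (n : ℕ) : List α := (List.replicate n u).flatten

theorem wordPow_succ (u : List α) (n : ℕ) : wordPow u (n + 1) = u ++ wordPow u n := by
  simp [wordPow, List.replicate_succ]

theorem length_wordPow (u : List α) (n : ℕ) : (wordPow u n).length = n * u.length := by
  simp [wordPow]

theorem IsLoop.wordPow {z u : List α} (hu : IsLoop z u) (n : ℕ) : IsLoop z (wordPow u n) := by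
  induction n with
  | zero => simp [Semiconstrained.wordPow, IsLoop]
  | succ n ih =>
    rw [wordPow_succ]
    exact hu.append ih

theorem loopCount_wordPow {z u : List α} (hz : z.length = m) (hu : IsLoop z u) (n : ℕ) :
    loopCount m z (wordPow u n) = (n : ℝ) • loopCount m z u := by
  induction n with
  | zero => simp [wordPow, loopCount_nil hz]
  | succ n ih =>
    rw [wordPow_succ, loopCount_append hz hu, ih]
    push_cast
    rw [add_smul, one_smul]
    exact add_comm _ _

theorem freq_loop {z : List α} (hz : z.length = m) (u : List α) :
    freq (m + 1) (z ++ u) = (u.length : ℝ)⁻¹ • loopCount m z u := by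
  rw [freq_eq, loopCount]
  congr 2
  simp [hz]

theorem sum_loopCount [Fintype α] {z : List α} (hz : z.length = m) (u : List α) :
    ∑ β, loopCount m z u β = u.length := by
  rw [loopCount, sum_countVec (by simp [hz])]
  simp [hz]

/-- The two boundary terms of `countVec_flow` cancel, since z is both the prefix and the suffix of
length m of z ++ u. -/
theorem loopCount_flow [Fintype α] {z u : List α} (hz : z.length = m) (hu : IsLoop z u)
    (φ : Fin m → α) :
    ∑ a, loopCount m z u (prependLetter a φ) = ∑ a, loopCount m z u (appendLetter φ a) := by
  classical
  have h := countVec_flow (m := m) (l := z ++ u) (by simp [hz]) φ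
  have h1 : List.ofFn φ <:+ z ++ u ↔ List.ofFn φ = z := by
    constructor
    · intro hs
      exact (List.suffix_of_suffix_length_le hs hu (by simp [hz])).eq_of_length (by simp [hz])
    · intro hs
      rw [hs]
      exact hu
  have h2 : List.ofFn φ <+: z ++ u ↔ List.ofFn φ = z := by
    rw [prefix_append_iff u (by simp [hz])]
    exact ⟨fun hs => hs.eq_of_length (by simp [hz]), fun hs => hs ▸ List.prefix_refl _⟩
  simp only [h1, h2, sub_self] at h
  exact sub_eq_zero.1 h

theorem freq_loop_mem [Fintype α] {z u : List α} (hz : z.length = m) (hu : IsLoop z u)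
    (hne : u ≠ []) : freq (m + 1) (z ++ u) ∈ shiftInvariantMeasures α (m + 1) := by
  have hpos : (u.length : ℝ) ≠ 0 := by simpa using hne
  rw [freq_loop hz]
  refine ⟨⟨fun β => ?_, ?_⟩, fun φ => ?_⟩
  · exact mul_nonneg (by positivity) (countVec_nonneg _ _)
  · simp only [Pi.smul_apply, smul_eq_mul, ← Finset.mul_sum]
    rw [sum_loopCount hz, inv_mul_cancel₀ hpos]
  · simp only [Pi.smul_apply, smul_eq_mul, ← Finset.mul_sum]
    rw [loopCount_flow hz hu φ]

/-- The frequency vectors of the nonempty words that return to `z`. -/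
def loopFreqs (z : List α) (m : ℕ) : Set ((Fin (m + 1) → α) → ℝ) :=
  {η | ∃ u, IsLoop z u ∧ u ≠ [] ∧ freq (m + 1) (z ++ u) = η}

open Filter Topology in
theorem combo_mem_closure_loopFreqs {z u v : List α} (hz : z.length = m)
    (hu : IsLoop z u) (hv : IsLoop z v) (hu0 : u ≠ []) (hv0 : v ≠ []) {a b : ℝ} (ha : 0 ≤ a)
    (hb : 0 ≤ b) (hab : a + b = 1) :
    a • freq (m + 1) (z ++ u) + b • freq (m + 1) (z ++ v) ∈ closure (loopFreqs z m) := by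
  have ha1 : a ≤ 1 := by linarith
  have hlim : Tendsto (fun n : ℕ => (⌊a * n⌋₊ : ℝ) / n) atTop (𝓝 a) :=
    (tendsto_nat_floor_mul_div_atTop ha).comp tendsto_natCast_atTop_atTop
  have hlim2 : Tendsto (fun n : ℕ => ((⌊a * n⌋₊ : ℝ) / n) • freq (m + 1) (z ++ u) +
      (1 - (⌊a * n⌋₊ : ℝ) / n) • freq (m + 1) (z ++ v)) atTop
      (𝓝 (a • freq (m + 1) (z ++ u) + (1 - a) • freq (m + 1) (z ++ v))) :=
    (hlim.smul_const _).add ((tendsto_const_nhds.sub hlim).smul_const _)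
  have hb' : b = 1 - a := by linarith
  rw [hb']
  refine mem_closure_of_tendsto hlim2 ?_
  filter_upwards [eventually_gt_atTop 0] with n hn
  set i := ⌊a * n⌋₊
  have hin : i ≤ n := by
    have : a * n ≤ n := mul_le_of_le_one_left (Nat.cast_nonneg _) ha1
    exact Nat.floor_le_of_le this
  clear_value i
  have hul : 0 < u.length := List.length_pos_iff.2 hu0
  have hvl : 0 < v.length := List.length_pos_iff.2 hv0
  -- Repeating u in multiples of |v| and v in multiples of |u| compensates for unequal lengths: the
  -- two blocks occupy exactly the fractions i/n and 1 - i/n of the word.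
  have hlen : (wordPow u (v.length * i) ++ wordPow v (u.length * (n - i))).length =
      u.length * v.length * n := by
    simp only [List.length_append, length_wordPow]
    obtain ⟨j, rfl⟩ := Nat.exists_eq_add_of_le hin
    rw [Nat.add_sub_cancel_left]
    ring
  refine ⟨wordPow u (v.length * i) ++ wordPow v (u.length * (n - i)),
    (hu.wordPow _).append (hv.wordPow _), ?_, ?_⟩
  · intro h
    rw [h, List.length_nil] at hlen
    have : 0 < u.length * v.length * n := by positivity
    omega
  · simp only [freq_loop hz]
    rw [hlen, loopCount_append hz (hu.wordPow _), loopCount_wordPow hz hu,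
      loopCount_wordPow hz hv, smul_add, smul_smul, smul_smul, smul_smul, smul_smul]
    have h1 : (u.length : ℝ) ≠ 0 := by positivity
    have h2 : (v.length : ℝ) ≠ 0 := by positivity
    have h3 : (n : ℝ) ≠ 0 := by positivity
    congr 2
    · push_cast
      field_simp
    · push_cast [Nat.cast_sub hin]
      field_simp

theorem convex_closure_loopFreqs {z : List α} (hz : z.length = m) :
    Convex ℝ (closure (loopFreqs z m)) := by
  intro x hx y hy a b ha hb hab
  rw [← closure_closure (s := loopFreqs z m)]
  refine map_mem_closure₂ (f := fun x y : (Fin (m + 1) → α) → ℝ => a • x + b • y)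
    (by fun_prop) hx hy ?_
  rintro _ ⟨u, hu, hu0, rfl⟩ _ ⟨v, hv, hv0, rfl⟩
  exact combo_mem_closure_loopFreqs hz hu hv hu0 hv0 ha hb hab

end Loops

/-! ### Density of loop frequencies in the shift-invariant measures -/

section Density

variable {α : Type*} {m : ℕ}

theorem norm_countVec_append_left_sub_le [Fintype α] {l : List α} (h : m ≤ l.length)
    (x : List α) : ‖countVec m (x ++ l) - countVec m l‖ ≤ x.length := by
  have hs : (l.take m).length = m := by simp [h]
  have := countVec_overlap hs x (l.drop m)
  rw [List.append_assoc, List.take_append_drop] at this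
  rw [this, add_sub_cancel_right]
  refine (norm_countVec_le (by simp [h])).trans_eq ?_
  simp [h]

theorem norm_countVec_append_right_sub_le [Fintype α] {l : List α} (h : m ≤ l.length)
    (y : List α) : ‖countVec m (l ++ y) - countVec m l‖ ≤ y.length := by
  have hs : (l.drop (l.length - m)).length = m := by
    rw [List.length_drop]
    omega
  have := countVec_overlap hs (l.take (l.length - m)) y
  rw [List.take_append_drop] at this
  rw [this, add_sub_cancel_left]
  refine (norm_countVec_le (by rw [List.length_append]; omega)).trans_eq ?_
  rw [List.length_append, hs]
  simp

theorem norm_countVec_append_sub_le [Fintype α] {l : List α} (h : m ≤ l.length)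
    (x y : List α) : ‖countVec m (x ++ (l ++ y)) - countVec m l‖ ≤ x.length + y.length := by
  have h1 := norm_countVec_append_left_sub_le (m := m) (l := l ++ y) (by simp; omega) x
  have h2 := norm_countVec_append_right_sub_le h y
  calc _ ≤ _ := norm_sub_le_norm_sub_add_norm_sub _ (countVec m (l ++ y)) _
    _ ≤ _ := add_le_add h1 h2

theorem sum_prependLetter [Fintype α] {M : Type*} [AddCommMonoid M]
    (g : (Fin (m + 1) → α) → M) :
    ∑ φ : Fin m → α, ∑ a, g (prependLetter a φ) = ∑ β, g β := by
  rw [Finset.sum_comm, ← Fintype.sum_prod_type']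
  refine Fintype.sum_equiv (Fin.consEquiv fun _ => α) _ _ fun p => ?_
  congr 1
  ext i
  refine Fin.cases ?_ (fun j => ?_) i <;> simp [prependLetter, Fin.consEquiv]

theorem sum_appendLetter [Fintype α] {M : Type*} [AddCommMonoid M]
    (g : (Fin (m + 1) → α) → M) :
    ∑ φ : Fin m → α, ∑ a, g (appendLetter φ a) = ∑ β, g β := by
  rw [Finset.sum_comm, ← Fintype.sum_prod_type']
  refine Fintype.sum_equiv (Fin.snocEquiv fun _ => α) _ _ fun p => ?_
  congr 1

/-- The last `m` letters of a word of length `m + 1`. -/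
def tailLetters (β : Fin (m + 1) → α) : Fin m → α := fun i => β i.succ

theorem ofFn_eq_cons (β : Fin (m + 1) → α) :
    List.ofFn β = β 0 :: List.ofFn (tailLetters β) := List.ofFn_succ

theorem tailLetters_prependLetter (a : α) (φ : Fin m → α) :
    tailLetters (prependLetter (k := m + 1) a φ) = φ := by
  ext i
  simp [tailLetters, prependLetter]

open Classical in
theorem countVec_cons {l : List α} {β : Fin (m + 1) → α}
    (h : List.ofFn (tailLetters β) <+: l) :
    countVec m (β 0 :: l) = Pi.single β 1 + countVec m l := by
  ext γ
  simp only [countVec, windowCount, Pi.add_apply, Nat.cast_add, Nat.cast_ite, Nat.cast_one,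
    Nat.cast_zero]
  have hβ : List.ofFn β <+: β 0 :: l := by
    rw [ofFn_eq_cons, List.cons_prefix_cons]
    exact ⟨rfl, h⟩
  by_cases hγ : γ = β
  · subst hγ
    rw [if_pos hβ, Pi.single_eq_same]
  · rw [Pi.single_eq_of_ne hγ, if_neg]
    intro hp
    refine hγ (List.ofFn_injective ?_)
    exact (List.prefix_of_prefix_length_le hp hβ (by simp)).eq_of_length (by simp)

/-- Dynamic programming: for a shift-invariant `η` and a linear functional `F` there are words of
any length whose window counts, on average over the initial `m` letters, score at least as well
as `η`. -/
theorem exists_scores [Fintype α] [Nonempty α] {η : (Fin (m + 1) → α) → ℝ}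
    (hη : η ∈ shiftInvariantMeasures α (m + 1)) (F : ((Fin (m + 1) → α) → ℝ) →ₗ[ℝ] ℝ) (n : ℕ) :
    ∃ V : (Fin m → α) → ℝ,
      (∀ φ, ∃ l : List α, l.length = n + m ∧ List.ofFn φ <+: l ∧ V φ = F (countVec m l)) ∧
      n * F η ≤ ∑ φ : Fin m → α, (∑ a, η (appendLetter φ a)) * V φ := by
  classical
  induction n with
  | zero =>
    refine ⟨fun _ => 0, fun φ => ⟨List.ofFn φ, by simp, List.prefix_refl _, ?_⟩, by simp⟩
    have : countVec m (List.ofFn φ) = 0 := by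
      ext β
      rw [countVec, windowCount_eq_zero (by simp)]
      simp
    rw [this, map_zero]
  | succ n ih =>
    obtain ⟨V, hV, hsum⟩ := ih
    set g : (Fin (m + 1) → α) → ℝ := fun β => F (Pi.single β 1) + V (tailLetters β) with hg
    have hmax : ∀ φ : Fin m → α, ∃ a, ∀ b,
        g (appendLetter φ b) ≤ g (appendLetter φ a) := fun φ =>
      Finite.exists_max fun a => g (appendLetter φ a)
    choose A hA using hmax
    refine ⟨fun φ => g (appendLetter φ (A φ)), fun φ => ?_, ?_⟩
    · obtain ⟨l, hl, hp, hval⟩ := hV (tailLetters (appendLetter (k := m + 1) φ (A φ)))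
      set β : Fin (m + 1) → α := appendLetter φ (A φ) with hβ
      refine ⟨β 0 :: l, by simp [hl]; ring, ?_, ?_⟩
      · refine List.IsPrefix.trans (l₂ := List.ofFn β) ?_ ?_
        · rw [hβ, ofFn_appendLetter]
          exact List.prefix_append _ _
        · rw [ofFn_eq_cons, List.cons_prefix_cons]
          exact ⟨rfl, hp⟩
      · rw [countVec_cons hp, map_add, ← hval]
    · have hF : F η = ∑ β, η β * F (Pi.single β 1) := by
        conv_lhs => rw [LinearMap.pi_apply_eq_sum_univ F η]
        refine Finset.sum_congr rfl fun β _ => ?_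
        rw [smul_eq_mul]
        congr 2
        ext γ
        simp [Pi.single_apply, eq_comm]
      -- Shift-invariance enters here: the marginal of η on the last m letters, which weights V in
      -- the sum over β, equals the marginal on the first m letters.
      have hsplit : ∑ β, η β * g β = F η + ∑ φ : Fin m → α, (∑ a, η (appendLetter φ a)) * V φ := by
        simp only [hg, mul_add, Finset.sum_add_distrib, ← hF]
        congr 1
        rw [← sum_prependLetter]
        refine Finset.sum_congr rfl fun φ _ => ?_
        simp only [tailLetters_prependLetter]
        rw [← Finset.sum_mul]
        congr 1
        exact hη.2 φ
      calc ((n + 1 : ℕ) : ℝ) * F η = F η + n * F η := by push_cast; ring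
        _ ≤ ∑ β, η β * g β := by rw [hsplit]; gcongr
        _ = ∑ φ : Fin m → α, ∑ a, η (appendLetter φ a) * g (appendLetter φ a) :=
          (sum_appendLetter fun β => η β * g β).symm
        _ ≤ ∑ φ : Fin m → α, (∑ a, η (appendLetter φ a)) * g (appendLetter φ (A φ)) := by
          refine Finset.sum_le_sum fun φ _ => ?_
          rw [Finset.sum_mul]
          exact Finset.sum_le_sum fun a _ => mul_le_mul_of_nonneg_left (hA φ a) (hη.1.1 _)

/-- The bound of `exists_scores` is for an average with weights of total mass 1, so some initial
word attains it. -/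
theorem exists_word_score [Fintype α] [Nonempty α] {η : (Fin (m + 1) → α) → ℝ}
    (hη : η ∈ shiftInvariantMeasures α (m + 1)) (F : ((Fin (m + 1) → α) → ℝ) →ₗ[ℝ] ℝ) (n : ℕ) :
    ∃ l : List α, l.length = n + m ∧ n * F η ≤ F (countVec m l) := by
  obtain ⟨V, hV, hsum⟩ := exists_scores hη F n
  by_contra! hcon
  have hlt : ∀ φ, V φ < n * F η := fun φ => by
    obtain ⟨l, hl, -, hval⟩ := hV φ
    rw [hval]
    exact hcon l hl
  have hone : ∑ φ : Fin m → α, ∑ a, η (appendLetter φ a) = 1 :=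
    (sum_appendLetter η).trans hη.1.2
  obtain ⟨φ, -, hφ⟩ : ∃ φ ∈ Finset.univ, (0 : ℝ) < ∑ a, η (appendLetter (k := m + 1) φ a) := by
    by_contra! h
    have := Finset.sum_nonpos h
    linarith [hone.symm.trans_le this]
  refine absurd hsum (not_le.2 ?_)
  calc ∑ φ : Fin m → α, (∑ a, η (appendLetter φ a)) * V φ
      < ∑ φ : Fin m → α, (∑ a, η (appendLetter φ a)) * (n * F η) := by
        refine Finset.sum_lt_sum (fun ψ _ => ?_) ⟨φ, Finset.mem_univ _, ?_⟩
        · exact mul_le_mul_of_nonneg_left (hlt ψ).le (Finset.sum_nonneg fun a _ => hη.1.1 _)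
        · exact mul_lt_mul_of_pos_left (hlt φ) hφ
    _ = n * F η := by rw [← Finset.sum_mul, hone, one_mul]

/-- Every shift-invariant measure is a limit of frequency vectors of words returning to `z`. -/
theorem mem_closure_loopFreqs [Fintype α] [Nonempty α] {z : List α} (hz : z.length = m)
    {η : (Fin (m + 1) → α) → ℝ} (hη : η ∈ shiftInvariantMeasures α (m + 1)) :
    η ∈ closure (loopFreqs z m) := by
  by_contra hcon
  obtain ⟨F, s, hFs, hsη⟩ :=
    geometric_hahn_banach_closed_point (convex_closure_loopFreqs hz) isClosed_closure hcon
  -- Closing l into the loop l ++ z costs at most 2m‖F‖ in score and 2m in length, so separation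
  -- would force (n + 1)(F η - s) < 2m(s + ‖F‖).
  obtain ⟨n, hn⟩ := exists_nat_gt (2 * m * (s + ‖F‖) / (F η - s))
  have hpos : 0 < F η - s := sub_pos.2 hsη
  rw [div_lt_iff₀ hpos] at hn
  obtain ⟨l, hl, hscore⟩ := exists_word_score hη F.toLinearMap (n + 1)
  have hne : l ++ z ≠ [] := by
    intro h
    have := congrArg List.length h
    simp [hl] at this
  have hlt := hFs _ (subset_closure ⟨l ++ z, isLoop_append_self z l, hne, rfl⟩)
  have hlen : ((l ++ z).length : ℝ) = n + 1 + 2 * m := by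
    simp only [List.length_append, hl, hz]
    push_cast
    ring
  rw [freq_loop hz, map_smul, smul_eq_mul, hlen, inv_mul_eq_div,
    div_lt_iff₀ (by positivity)] at hlt
  have herr := norm_countVec_append_sub_le (m := m) (l := l) (by omega) z z
  have hF := F.le_opNorm (loopCount m z (l ++ z) - countVec m l)
  have hF2 : ‖F‖ * ‖loopCount m z (l ++ z) - countVec m l‖ ≤ ‖F‖ * (m + m) := by
    refine mul_le_mul_of_nonneg_left (herr.trans_eq ?_) (norm_nonneg _)
    rw [hz]
  rw [map_sub, Real.norm_eq_abs] at hF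
  have habs := neg_abs_le (F (loopCount m z (l ++ z)) - F (countVec m l))
  have hscore' : ((n + 1 : ℕ) : ℝ) * F η ≤ F (countVec m l) := hscore
  push_cast at hscore'
  nlinarith

end Density

/-! ### Correcting admissible words to loops with frequency in Γ -/

section Admissible

variable {α : Type*} {m : ℕ}

/-- How far `y` is from satisfying the equations of shift-invariance. -/
noncomputable def shiftDefect [Fintype α] (y : (Fin (m + 1) → α) → ℝ) : ℝ :=
  ∑ φ : Fin m → α, |(∑ a, y (prependLetter a φ)) - ∑ a, y (appendLetter φ a)|

theorem shiftDefect_pos [Fintype α] {y : (Fin (m + 1) → α) → ℝ}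
    (hy : y ∈ probMeasures α (m + 1)) (hy' : y ∉ shiftInvariantMeasures α (m + 1)) :
    0 < shiftDefect y := by
  refine lt_of_le_of_ne (Finset.sum_nonneg fun _ _ => abs_nonneg _) fun h => hy' ⟨hy, fun φ => ?_⟩
  have := (Finset.sum_eq_zero_iff_of_nonneg fun _ _ => abs_nonneg _).1 h.symm φ
    (Finset.mem_univ _)
  exact sub_eq_zero.1 (abs_eq_zero.1 this)

theorem continuous_shiftDefect [Fintype α] :
    Continuous (shiftDefect : ((Fin (m + 1) → α) → ℝ) → ℝ) := by
  unfold shiftDefect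
  fun_prop

theorem shiftDefect_freq_mul_le [Fintype α] {l : List α} (h : m < l.length) :
    shiftDefect (freq (m + 1) l) * ((l.length : ℝ) - m) ≤ Fintype.card (Fin m → α) := by
  have hpos : 0 < (l.length : ℝ) - m := by
    rw [sub_pos]
    exact_mod_cast h
  have key : ∀ φ : Fin m → α, |(∑ a, freq (m + 1) l (prependLetter a φ)) -
      ∑ a, freq (m + 1) l (appendLetter φ a)| * ((l.length : ℝ) - m) ≤ 1 := by
    intro φ
    simp only [freq_eq, Pi.smul_apply, smul_eq_mul]
    rw [← Finset.mul_sum, ← Finset.mul_sum, ← mul_sub, abs_mul, abs_inv, abs_of_pos hpos,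
      mul_right_comm, inv_mul_cancel₀ hpos.ne', one_mul]
    exact abs_countVec_flow_le h.le φ
  rw [shiftDefect, Finset.sum_mul]
  refine (Finset.sum_le_sum fun φ _ => key φ).trans_eq ?_
  simp

/-- Away from Γ ∩ P_si the shift defect has a positive minimum on the compact set Γ, while for
empirical frequencies it is O(1/length). In particular, arbitrarily long admissible words force Γ ∩
P_si to be nonempty. -/
theorem exists_near_shiftInvariant [Fintype α] {Γ : Set ((Fin (m + 1) → α) → ℝ)}
    (hΓ : Γ ⊆ probMeasures α (m + 1)) (hclosed : IsClosed Γ) {ε : ℝ} (hε : 0 < ε) :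
    ∃ N : ℕ, ∀ l ∈ admissible Γ, N ≤ l.length →
      ∃ ζ ∈ Γ ∩ shiftInvariantMeasures α (m + 1), ‖freq (m + 1) l - ζ‖ < ε := by
  set K := Γ ∩ shiftInvariantMeasures α (m + 1)
  have hcomp : IsCompact Γ := (isCompact_stdSimplex ℝ _).of_isClosed_subset hclosed hΓ
  have hT : IsCompact (Γ \ Metric.thickening ε K) := hcomp.diff Metric.isOpen_thickening
  obtain ⟨δ, hδ, hmin⟩ := hT.exists_forall_le' (a := 0) continuous_shiftDefect.continuousOn
    (fun y hy => shiftDefect_pos (hΓ hy.1)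
      fun hsi => hy.2 (Metric.self_subset_thickening hε K ⟨hy.1, hsi⟩))
  obtain ⟨N, hN⟩ := exists_nat_gt (Fintype.card (Fin m → α) / δ)
  rw [div_lt_iff₀ hδ] at hN
  refine ⟨N + m, fun l hl hlen => ?_⟩
  by_contra! hcon
  have hnot : freq (m + 1) l ∉ Metric.thickening ε K := by
    rw [Metric.mem_thickening_iff]
    rintro ⟨ζ, hζ, hd⟩
    rw [dist_eq_norm] at hd
    exact absurd hd (not_lt.2 (hcon ζ hζ))
  have h1 := hmin _ ⟨hl.2, hnot⟩
  have h2 := shiftDefect_freq_mul_le (m := m) (l := l) hl.1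
  have h3 : (N : ℝ) ≤ (l.length : ℝ) - m := by
    rw [le_sub_iff_add_le]
    exact_mod_cast hlen
  have h4 : δ * N ≤ shiftDefect (freq (m + 1) l) * ((l.length : ℝ) - m) :=
    mul_le_mul h1 h3 (Nat.cast_nonneg _) (hδ.le.trans h1)
  linarith

theorem uniform_mem_shiftInvariant [Fintype α] [Nonempty α] :
    (fun _ => (Fintype.card (Fin (m + 1) → α) : ℝ)⁻¹) ∈ shiftInvariantMeasures α (m + 1) := by
  refine ⟨⟨fun _ => by positivity, ?_⟩, fun φ => rfl⟩
  simp

theorem convex_shiftInvariantMeasures [Fintype α] :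
    Convex ℝ (shiftInvariantMeasures α (m + 1)) := by
  intro x hx y hy a b ha hb hab
  refine ⟨convex_stdSimplex ℝ _ hx.1 hy.1 ha hb hab, fun φ => ?_⟩
  simp only [Pi.add_apply, Pi.smul_apply, Finset.sum_add_distrib, ← Finset.smul_sum]
  rw [hx.2 φ, hy.2 φ]

/-- Around the frequency vector of some word returning to `z`, the set `Γ` contains a ball of the
affine space spanned by the shift-invariant measures. -/
theorem exists_interior_loop [Fintype α] [Nonempty α] {Γ : Set ((Fin (m + 1) → α) → ℝ)}
    (hfat : IsFat Γ) (hne : (Γ ∩ shiftInvariantMeasures α (m + 1)).Nonempty)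
    {z : List α} (hz : z.length = m) :
    ∃ v, IsLoop z v ∧ v ≠ [] ∧ ∃ r > 0, ∀ y : (Fin (m + 1) → α) → ℝ, ∑ β, y β = 1 →
      (∀ φ : Fin m → α, ∑ a, y (prependLetter a φ) = ∑ a, y (appendLetter φ a)) →
      ‖y - freq (m + 1) (z ++ v)‖ < r → y ∈ Γ := by
  set U : Set (shiftInvariantMeasures α (m + 1)) :=
    interior {η : shiftInvariantMeasures α (m + 1) | (η : (Fin (m + 1) → α) → ℝ) ∈ Γ} with hU
  have hUne : U.Nonempty := by
    rw [← closure_nonempty_iff, hU, hfat, closure_nonempty_iff]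
    obtain ⟨x, hx, hsi⟩ := hne
    exact ⟨⟨x, hsi⟩, hx⟩
  obtain ⟨O, hO, hOU⟩ : ∃ O, IsOpen O ∧ Subtype.val ⁻¹' O = U :=
    isOpen_induced_iff.1 isOpen_interior
  have hmem : ∀ x ∈ O, x ∈ shiftInvariantMeasures α (m + 1) → x ∈ Γ := fun x hx hsi => by
    have : (⟨x, hsi⟩ : shiftInvariantMeasures α (m + 1)) ∈ U := by
      rw [← hOU]
      exact hx
    have h : (⟨x, hsi⟩ : shiftInvariantMeasures α (m + 1)) ∈
        {η : shiftInvariantMeasures α (m + 1) | (η : (Fin (m + 1) → α) → ℝ) ∈ Γ} :=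
      interior_subset this
    exact h
  obtain ⟨⟨η, hsi⟩, hη⟩ := hUne
  have hηO : η ∈ O := by
    rw [← hOU] at hη
    exact hη
  -- Mixing in a little of the uniform measure makes all coordinates positive. A small ball then
  -- stays in the positive orthant, so the affine equations alone guarantee membership in P_si.
  set e : (Fin (m + 1) → α) → ℝ := fun _ => (Fintype.card (Fin (m + 1) → α) : ℝ)⁻¹ with he
  have hcont : Continuous fun t : ℝ => (1 - t) • η + t • e := by fun_prop
  have hev : ∀ᶠ t in nhdsWithin (0 : ℝ) (Set.Ioi 0), (1 - t) • η + t • e ∈ O :=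
    (hcont.continuousAt.eventually_mem (by simpa using hO.mem_nhds hηO)).filter_mono
      nhdsWithin_le_nhds
  obtain ⟨t, htO, ht⟩ := (hev.and (Ioo_mem_nhdsGT (zero_lt_one' ℝ))).exists
  set P : Set ((Fin (m + 1) → α) → ℝ) := {x | ∀ β, 0 < x β} with hP
  have hPopen : IsOpen P := by
    rw [hP, Set.ofPred_forall]
    exact isOpen_iInter_of_finite fun β => isOpen_lt continuous_const (continuous_apply β)
  have hpos : (1 - t) • η + t • e ∈ P := by
    intro β
    have h1 : 0 ≤ (1 - t) * η β := mul_nonneg (by linarith [ht.2]) (hsi.1.1 β)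
    have h2 : 0 < t * e β := mul_pos ht.1 (by simp only [he]; positivity)
    simp only [Pi.add_apply, Pi.smul_apply, smul_eq_mul]
    linarith
  have hsi' : (1 - t) • η + t • e ∈ shiftInvariantMeasures α (m + 1) :=
    convex_shiftInvariantMeasures hsi uniform_mem_shiftInvariant (by linarith [ht.2]) ht.1.le
      (by ring)
  obtain ⟨_, hxO, v, hv, hv0, rfl⟩ := mem_closure_iff.1 (mem_closure_loopFreqs hz hsi') (O ∩ P)
    (hO.inter hPopen) ⟨htO, hpos⟩
  obtain ⟨r, hr, hball⟩ := Metric.isOpen_iff.1 (hO.inter hPopen) _ hxO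
  refine ⟨v, hv, hv0, r, hr, fun y hy1 hyf hyr => ?_⟩
  have hy := hball (mem_ball_iff_norm.2 hyr)
  exact hmem y hy.1 ⟨⟨fun β => (hy.2 β).le, hy1⟩, hyf⟩

/-- Extending the loop `x`, whose counts are close to those of an admissible word, by enough
copies of the interior loop `v` leads into `Γ`. -/
theorem exists_threshold [Fintype α] {Γ : Set ((Fin (m + 1) → α) → ℝ)}
    (hΓ : Γ ⊆ probMeasures α (m + 1)) (hclosed : IsClosed Γ) (hconvex : Convex ℝ Γ)
    {z v : List α} (hz : z.length = m) (hv : IsLoop z v) (hv0 : v ≠ []) {r : ℝ} (hr : 0 < r)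
    (hball : ∀ y : (Fin (m + 1) → α) → ℝ, ∑ β, y β = 1 →
      (∀ φ : Fin m → α, ∑ a, y (prependLetter a φ) = ∑ a, y (appendLetter φ a)) →
      ‖y - freq (m + 1) (z ++ v)‖ < r → y ∈ Γ) {s : ℕ} (hs : 0 < s) (c : ℕ) :
    ∃ N : ℕ, ∀ l ∈ admissible Γ, N ≤ l.length → ∀ x, IsLoop z x →
      ‖loopCount m z x - countVec m l‖ ≤ c → |(x.length : ℝ) - (l.length - m)| ≤ c →
      ∀ R : ℕ, l.length ≤ R * s → freq (m + 1) (z ++ (x ++ wordPow v R)) ∈ Γ := by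
  have hs' : (0 : ℝ) < s := by exact_mod_cast hs
  obtain ⟨N₁, hN₁⟩ := exists_near_shiftInvariant hΓ hclosed (ε := r / (2 * s)) (by positivity)
  -- The error to absorb is at most 2c + |l| r/(2s), and the copies of v have total length M ≥
  -- |l|/s. For |l| > 4cs/r the error is less than M r.
  obtain ⟨N₂, hN₂⟩ := exists_nat_gt (4 * c * s / r)
  rw [div_lt_iff₀ hr] at hN₂
  refine ⟨max N₁ N₂, fun l hl hlen x hx hxc hxl R hR => ?_⟩
  obtain ⟨ζ, ⟨hζΓ, hζ⟩, hnear⟩ := hN₁ l hl ((le_max_left _ _).trans hlen)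
  have hlN₂ : (N₂ : ℝ) ≤ l.length := by exact_mod_cast (le_max_right _ _).trans hlen
  have hml : (m : ℝ) + 1 ≤ l.length := by exact_mod_cast hl.1
  have hm0 : (0 : ℝ) ≤ m := Nat.cast_nonneg m
  have hRpos : 0 < R := by
    rcases Nat.eq_zero_or_pos R with h | h
    · have := hl.1
      rw [h, zero_mul] at hR
      omega
    · exact h
  have hvl : 0 < v.length := List.length_pos_iff.2 hv0
  set M : ℝ := (R : ℝ) * v.length with hM
  have hMR : (R : ℝ) ≤ M := by
    rw [hM]
    exact le_mul_of_one_le_right (Nat.cast_nonneg _) (by exact_mod_cast hvl)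
  have hMpos : 0 < M := by positivity
  set ν := freq (m + 1) (z ++ v) with hν
  have hνeq : loopCount m z v = (v.length : ℝ) • ν := by
    rw [hν, freq_loop hz, smul_inv_smul₀ (by positivity)]
  -- The whole deviation of x from ζ is charged to the copies of v: the final frequency is a convex
  -- combination of ζ and y, with y within r of ν.
  set y : (Fin (m + 1) → α) → ℝ :=
    ν + M⁻¹ • (loopCount m z x - (x.length : ℝ) • ζ) with hy
  have hνsi := freq_loop_mem (m := m) hz hv hv0
  have hyΓ : y ∈ Γ := by
    refine hball y ?_ (fun φ => ?_) ?_
    · simp only [hy, Pi.add_apply, Pi.smul_apply, Pi.sub_apply, Finset.sum_add_distrib,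
        ← Finset.smul_sum, Finset.sum_sub_distrib, sum_loopCount hz]
      rw [hνsi.1.2, hζ.1.2]
      simp
    · simp only [hy, Pi.add_apply, Pi.smul_apply, Pi.sub_apply, Finset.sum_add_distrib,
        ← Finset.smul_sum, Finset.sum_sub_distrib]
      rw [loopCount_flow hz hx φ, hνsi.2 φ, hζ.2 φ]
    · rw [hy, add_sub_cancel_left, norm_smul, Real.norm_of_nonneg (by positivity),
        inv_mul_lt_iff₀ hMpos]
      have hd : (0 : ℝ) < (l.length : ℝ) - m := by linarith
      have hsplit : loopCount m z x - (x.length : ℝ) • ζ =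
          (loopCount m z x - countVec m l) +
            (((l.length : ℝ) - m) • (freq (m + 1) l - ζ) -
              ((x.length : ℝ) - (l.length - m)) • ζ) := by
        rw [freq_eq, smul_sub, smul_inv_smul₀ hd.ne']
        module
      have hζnorm : ‖ζ‖ ≤ 1 := by
        rw [pi_norm_le_iff_of_nonneg zero_le_one]
        intro β
        rw [Real.norm_of_nonneg (hζ.1.1 β), ← hζ.1.2]
        exact Finset.single_le_sum (f := ζ) (fun γ _ => hζ.1.1 γ) (Finset.mem_univ β)
      have h1 : ‖((l.length : ℝ) - m) • (freq (m + 1) l - ζ)‖ ≤ l.length * (r / (2 * s)) := by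
        rw [norm_smul, Real.norm_of_nonneg hd.le]
        exact mul_le_mul (by linarith) hnear.le (norm_nonneg _) (Nat.cast_nonneg _)
      have h2 : ‖((x.length : ℝ) - (l.length - m)) • ζ‖ ≤ c := by
        rw [norm_smul, Real.norm_eq_abs]
        exact (mul_le_of_le_one_right (abs_nonneg _) hζnorm).trans hxl
      have h3 : ‖loopCount m z x - (x.length : ℝ) • ζ‖ ≤ c + (l.length * (r / (2 * s)) + c) := by
        rw [hsplit]
        exact (norm_add_le _ _).trans
          (add_le_add hxc ((norm_sub_le _ _).trans (add_le_add h1 h2)))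
      refine h3.trans_lt ?_
      have hRs : (l.length : ℝ) ≤ R * s := by exact_mod_cast hR
      have h4 : (l.length : ℝ) / s ≤ M := ((div_le_iff₀ hs').2 hRs).trans hMR
      have h5 : 4 * c < l.length / s * r := by
        rw [div_mul_eq_mul_div, lt_div_iff₀ hs']
        exact hN₂.trans_le (mul_le_mul_of_nonneg_right hlN₂ hr.le)
      have h6 : (l.length : ℝ) * (r / (2 * s)) = l.length / s * r / 2 := by
        field_simp
      have h7 : (l.length : ℝ) / s * r ≤ M * r := mul_le_mul_of_nonneg_right h4 hr.le
      rw [h6]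
      linarith
  have hlenpos : 0 < (x.length : ℝ) + M := by positivity
  have hfinal : freq (m + 1) (z ++ (x ++ wordPow v R)) =
      ((x.length : ℝ) / (x.length + M)) • ζ + (M / (x.length + M)) • y := by
    rw [freq_loop hz, loopCount_append hz hx, loopCount_wordPow hz hv, hνeq, List.length_append,
      length_wordPow]
    push_cast
    rw [← hM, smul_smul, ← hM, inv_smul_eq_iff₀ hlenpos.ne', smul_add, smul_smul, smul_smul,
      mul_div_cancel₀ _ hlenpos.ne', mul_div_cancel₀ _ hlenpos.ne', hy, smul_add,
      smul_inv_smul₀ hMpos.ne']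
    module
  rw [hfinal]
  refine hconvex hζΓ hyΓ (by positivity) (by positivity) ?_
  rw [← add_div, div_self hlenpos.ne']

theorem freq_loop_append_mem {Γ : Set ((Fin (m + 1) → α) → ℝ)} (hconvex : Convex ℝ Γ)
    {z u v : List α} (hz : z.length = m) (hu : IsLoop z u) (hu0 : u ≠ []) (hv0 : v ≠ [])
    (hfu : freq (m + 1) (z ++ u) ∈ Γ) (hfv : freq (m + 1) (z ++ v) ∈ Γ) :
    freq (m + 1) (z ++ (u ++ v)) ∈ Γ := by
  have hul : 0 < (u.length : ℝ) := by exact_mod_cast List.length_pos_iff.2 hu0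
  have hvl : 0 < (v.length : ℝ) := by exact_mod_cast List.length_pos_iff.2 hv0
  have hpos : 0 < (u.length : ℝ) + v.length := by positivity
  have : freq (m + 1) (z ++ (u ++ v)) =
      ((u.length : ℝ) / (u.length + v.length)) • freq (m + 1) (z ++ u) +
        ((v.length : ℝ) / (u.length + v.length)) • freq (m + 1) (z ++ v) := by
    simp only [freq_loop hz]
    rw [loopCount_append hz hu, List.length_append]
    push_cast
    rw [inv_smul_eq_iff₀ hpos.ne', smul_add, smul_smul, smul_smul, smul_smul, smul_smul]
    congr 1
    · rw [mul_div_cancel₀ _ hpos.ne', mul_inv_cancel₀ hul.ne', one_smul]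
    · rw [mul_div_cancel₀ _ hpos.ne', mul_inv_cancel₀ hvl.ne', one_smul]
  rw [this]
  refine hconvex hfu hfv (by positivity) (by positivity) ?_
  rw [← add_div, div_self hpos.ne']

end Admissible

/-! ### One-vertex graphs and comparison of capacities -/

section Capacity

variable {α : Type*}

/-- The graph with one vertex whose loops are labelled by the words `b i`. -/
def bouquet {N q : ℕ} (b : Fin N → Fin q → α) : LabeledGraph α q where
  V := Unit
  E := Fin N
  finite_V := inferInstance
  finite_E := inferInstance
  src := fun _ => ()
  tgt := fun _ => ()
  label := b

theorem bouquet_language {N q : ℕ} (b : Fin N → Fin q → α) :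
    (bouquet b).language =
      {ω | ∃ p : List (Fin N), p ≠ [] ∧ ω = p.flatMap fun i => List.ofFn (b i)} := by
  ext ω
  constructor
  · rintro ⟨p, hp, -, h⟩
    exact ⟨p, hp, h⟩
  · rintro ⟨p, hp, h⟩
    refine ⟨p, hp, ?_, h⟩
    exact (List.pairwise_of_forall fun _ _ => rfl).isChain

theorem length_flatMap_ofFn {ι : Type*} {q : ℕ} (b : ι → Fin q → α) (p : List ι) :
    (p.flatMap fun i => List.ofFn (b i)).length = p.length * q := by
  induction p with
  | nil => simp
  | cons i p ih =>
    rw [List.flatMap_cons, List.length_append, ih, List.length_ofFn, List.length_cons]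
    ring

theorem flatMap_ofFn_injective {ι : Type*} {q : ℕ} {b : ι → Fin q → α}
    (hb : Function.Injective b) {p p' : List ι} (hlen : p.length = p'.length)
    (h : (p.flatMap fun i => List.ofFn (b i)) = p'.flatMap fun i => List.ofFn (b i)) :
    p = p' := by
  induction p generalizing p' with
  | nil => exact (List.length_eq_zero_iff.1 hlen.symm).symm
  | cons i p ih =>
    cases p' with
    | nil => simp at hlen
    | cons j p' =>
      rw [List.flatMap_cons, List.flatMap_cons] at h
      obtain ⟨h1, h2⟩ := List.append_inj h (by simp)
      rw [hb (List.ofFn_injective h1), ih (by simpa using hlen) h2]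

theorem finite_words_of_length [Finite α] (S : Set (List α)) (n : ℕ) :
    {ω ∈ S | ω.length = n}.Finite :=
  (List.finite_length_eq α n).subset fun _ h => h.2

theorem elog2_mono {a b : ℕ} (h : a ≤ b) : elog2 a ≤ elog2 b := by
  rw [elog2, elog2]
  split_ifs with ha hb hb
  · exact le_rfl
  · exact bot_le
  · omega
  · rw [EReal.coe_le_coe_iff]
    exact Real.logb_le_logb_of_le one_lt_two (by exact_mod_cast Nat.pos_of_ne_zero ha)
      (by exact_mod_cast h)

theorem capacity_mono [Finite α] {S T : Set (List α)} (h : S ⊆ T) : capacity S ≤ capacity T := by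
  refine Filter.limsup_le_limsup (Filter.Eventually.of_forall fun n => ?_)
  refine mul_le_mul_of_nonneg_left (elog2_mono ?_) ?_
  · exact Set.ncard_le_ncard (fun ω hω => ⟨h hω.1, hω.2⟩) (finite_words_of_length T n)
  · exact EReal.coe_nonneg.2 (by positivity)

theorem containedCapacity_le [Fintype α] {k : ℕ} (Γ : Set ((Fin k → α) → ℝ)) :
    containedCapacity Γ ≤ capacity (admissible Γ) := by
  refine sSup_le ?_
  rintro c ⟨q, -, G, hG, rfl⟩
  exact capacity_mono hG

theorem pow_le_ncard_bouquet_language [Finite α] {N q : ℕ} {b : Fin N → Fin q → α}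
    (hb : Function.Injective b) {j : ℕ} (hj : 1 ≤ j) :
    N ^ j ≤ Set.ncard {ω ∈ (bouquet b).language | ω.length = j * q} := by
  have hinj : Function.Injective fun f : Fin j → Fin N =>
      (List.ofFn f).flatMap fun i => List.ofFn (b i) := fun f g hfg =>
    List.ofFn_injective (flatMap_ofFn_injective hb (by simp) hfg)
  have hcard : N ^ j = (Set.range fun f : Fin j → Fin N =>
      (List.ofFn f).flatMap fun i => List.ofFn (b i)).ncard := by
    rw [← Set.image_univ, Set.ncard_image_of_injective _ hinj, Set.ncard_univ]
    simp
  rw [hcard]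
  refine Set.ncard_le_ncard ?_ (finite_words_of_length _ _)
  rintro _ ⟨f, rfl⟩
  refine ⟨?_, by rw [length_flatMap_ofFn, List.length_ofFn]⟩
  rw [bouquet_language]
  refine ⟨List.ofFn f, ?_, rfl⟩
  intro h
  have := congrArg List.length h
  rw [List.length_ofFn, List.length_nil] at this
  omega

/-- Labels of equal length decode uniquely, so N^j words have length jq; the limsup needs only these
lengths. -/
theorem le_capacity_bouquet [Finite α] {N q : ℕ} (hN : 1 ≤ N) (hq : 1 ≤ q)
    {b : Fin N → Fin q → α} (hb : Function.Injective b) :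
    ((Real.logb 2 N / q : ℝ) : EReal) ≤ capacity (bouquet b).language := by
  refine Filter.le_limsup_of_frequently_le ?_
  rw [Filter.frequently_atTop]
  intro a
  refine ⟨(a + 1) * q, ?_, ?_⟩
  · exact (Nat.le_succ a).trans (Nat.le_mul_of_pos_right _ hq)
  have hpow := pow_le_ncard_bouquet_language hb (Nat.le_add_left 1 a)
  have hNpos : N ^ (a + 1) ≠ 0 := by positivity
  have h1 : ((Real.logb 2 N / q : ℝ) : EReal) =
      ((1 / ((a + 1) * q : ℕ) : ℝ) : EReal) * elog2 (N ^ (a + 1)) := by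
    rw [elog2, if_neg hNpos, ← EReal.coe_mul]
    congr 1
    have hq' : (q : ℝ) ≠ 0 := by positivity
    push_cast
    rw [Real.logb_pow]
    push_cast
    field_simp
  rw [h1]
  exact mul_le_mul_of_nonneg_left (elog2_mono hpow) (EReal.coe_nonneg.2 (by positivity))

theorem freq_flatten_mem {m : ℕ} {Γ : Set ((Fin (m + 1) → α) → ℝ)} (hconvex : Convex ℝ Γ)
    {z : List α} (hz : z.length = m) {L : List (List α)}
    (hL : ∀ w ∈ L, IsLoop z w ∧ w ≠ [] ∧ freq (m + 1) (z ++ w) ∈ Γ) {u : List α}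
    (hu : IsLoop z u) (hu0 : u ≠ []) (hfu : freq (m + 1) (z ++ u) ∈ Γ) :
    freq (m + 1) (z ++ (u ++ L.flatten)) ∈ Γ := by
  induction L generalizing u with
  | nil => simpa using hfu
  | cons w L ih =>
    obtain ⟨hw, hw0, hfw⟩ := hL w List.mem_cons_self
    rw [List.flatten_cons, ← List.append_assoc u]
    exact ih (fun w' hw' => hL w' (List.mem_cons_of_mem _ hw')) (hu.append hw) (by simp [hu0])
      (freq_loop_append_mem hconvex hz hu hu0 hw0 hfu hfw)

/-- A path reads z u₁ z u₂ z u₃ ⋯, that is, z followed by the loops u₁, z u₂, z u₃, …. Hence both u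
i and z ++ u i need frequencies in Γ. -/
theorem bouquet_language_subset {m N q : ℕ} {Γ : Set ((Fin (m + 1) → α) → ℝ)}
    (hconvex : Convex ℝ Γ) {z : List α} (hz : z.length = m) {b : Fin N → Fin q → α}
    {u : Fin N → List α} (hu : ∀ i, IsLoop z (u i)) (hu0 : ∀ i, u i ≠ [])
    (hb : ∀ i, List.ofFn (b i) = z ++ u i) (hfu : ∀ i, freq (m + 1) (z ++ u i) ∈ Γ)
    (hfz : ∀ i, freq (m + 1) (z ++ (z ++ u i)) ∈ Γ) :
    (bouquet b).language ⊆ admissible Γ := by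
  rw [bouquet_language]
  rintro _ ⟨p, hp, rfl⟩
  cases p with
  | nil => exact absurd rfl hp
  | cons i p =>
    rw [List.flatMap_cons, List.flatMap_def, hb, List.append_assoc]
    refine ⟨?_, freq_flatten_mem hconvex hz ?_ (hu i) (hu0 i) (hfu i)⟩
    · have := List.length_pos_iff.2 (hu0 i)
      rw [List.length_append, List.length_append]
      omega
    · intro w hw
      obtain ⟨j, -, rfl⟩ := List.mem_map.1 hw
      rw [hb]
      exact ⟨(hu j).prepend_self, by simp [hu0 j], hfz j⟩

theorem le_containedCapacity [Fintype α] {m : ℕ} {Γ : Set ((Fin (m + 1) → α) → ℝ)}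
    (hconvex : Convex ℝ Γ) {z : List α} (hz : z.length = m) {T : Set (List α)} (hT : T.Finite)
    (hTne : T.Nonempty) {u : List α → List α} (hinj : Set.InjOn u T) {q : ℕ} (hq : 1 ≤ q)
    (hlen : ∀ l ∈ T, (z ++ u l).length = q) (hu : ∀ l ∈ T, IsLoop z (u l))
    (hu0 : ∀ l ∈ T, u l ≠ []) (hfu : ∀ l ∈ T, freq (m + 1) (z ++ u l) ∈ Γ)
    (hfz : ∀ l ∈ T, freq (m + 1) (z ++ (z ++ u l)) ∈ Γ) :
    ((Real.logb 2 T.ncard / q : ℝ) : EReal) ≤ containedCapacity Γ := by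
  have : Finite T := hT
  let e : Fin T.ncard ≃ T := (Finite.equivFinOfCardEq (Nat.card_coe_set_eq T)).symm
  let b : Fin T.ncard → Fin q → α := fun i j =>
    (z ++ u (e i))[j.1]'(by rw [hlen _ (e i).2]; exact j.2)
  have hb : ∀ i, List.ofFn (b i) = z ++ u (e i) := by
    intro i
    apply List.ext_getElem
    · rw [List.length_ofFn, hlen _ (e i).2]
    · intro j h1 h2
      rw [List.getElem_ofFn]
  have hbinj : Function.Injective b := by
    intro i j hij
    have h := congrArg List.ofFn hij
    rw [hb, hb, List.append_cancel_left_eq] at h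
    exact e.injective (Subtype.ext (hinj (e i).2 (e j).2 h))
  refine (le_capacity_bouquet ((Set.ncard_pos hT).2 hTne) hq hbinj).trans (le_sSup ?_)
  exact ⟨q, hq, bouquet b, bouquet_language_subset hconvex hz (fun i => hu _ (e i).2)
    (fun i => hu0 _ (e i).2) hb (fun i => hfu _ (e i).2) (fun i => hfz _ (e i).2), rfl⟩

/-- The denominator is the length of the label z l z v^R with R = n / s + 1 and L = |v|. It matters
that L is chosen before s. -/
theorem exists_log_ncard_div_le [Fintype α] [Nonempty α] {m : ℕ}
    {Γ : Set ((Fin (m + 1) → α) → ℝ)} (hΓ : Γ ⊆ probMeasures α (m + 1))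
    (hclosed : IsClosed Γ) (hconvex : Convex ℝ Γ) (hfat : IsFat Γ)
    (hne : (Γ ∩ shiftInvariantMeasures α (m + 1)).Nonempty) :
    ∃ L : ℕ, ∀ s > 0, ∃ N₀ : ℕ, ∀ n ≥ N₀, {ω ∈ admissible Γ | ω.length = n}.Nonempty →
      ((Real.logb 2 (Set.ncard {ω ∈ admissible Γ | ω.length = n}) /
        (2 * m + n + (n / s + 1) * L : ℕ) : ℝ) : EReal) ≤ containedCapacity Γ := by
  obtain ⟨a⟩ := ‹Nonempty α›
  have hz : (List.replicate m a).length = m := List.length_replicate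
  set z := List.replicate m a
  obtain ⟨v, hv, hv0, r, hr, hball⟩ := exists_interior_loop hfat hne hz
  refine ⟨v.length, fun s hs => ?_⟩
  -- The constant 3m serves both loops l ++ z and z ++ (l ++ z); the second has the larger errors,
  -- 3m in counts and in length.
  obtain ⟨N₀, hN₀⟩ := exists_threshold hΓ hclosed hconvex hz hv hv0 hr hball hs (3 * m)
  refine ⟨N₀, fun n hn hTne => ?_⟩
  have hR : n ≤ (n / s + 1) * s := by
    rw [mul_comm]
    exact (Nat.lt_mul_div_succ n hs).le
  have hm0 : (0 : ℝ) ≤ m := Nat.cast_nonneg m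
  have hq : 1 ≤ 2 * m + n + (n / s + 1) * v.length := by
    have := List.length_pos_iff.2 hv0
    have : 0 < (n / s + 1) * v.length := by positivity
    omega
  refine le_containedCapacity hconvex hz (finite_words_of_length _ n) hTne
    (u := fun l => (l ++ z) ++ wordPow v (n / s + 1)) ?_ hq ?_ ?_ ?_ ?_ ?_
  · intro l _ l' _ h
    simpa using h
  · rintro l ⟨-, hl⟩
    simp only [List.length_append, hz, hl, length_wordPow]
    ring
  · rintro l -
    exact (isLoop_append_self z l).append (hv.wordPow _)
  · rintro l ⟨hl, -⟩ h
    have h1 := congrArg List.length h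
    have h2 := hl.1
    simp only [List.length_append, List.length_nil] at h1
    omega
  · rintro l ⟨hl, hln⟩
    refine hN₀ l hl (hln ▸ hn) (l ++ z) (isLoop_append_self z l) ?_ ?_ _ (by rw [hln]; exact hR)
    · refine (norm_countVec_append_sub_le (by have := hl.1; omega) z z).trans ?_
      rw [hz]
      push_cast
      linarith
    · rw [List.length_append, hz, abs_le]
      push_cast
      constructor <;> linarith
  · rintro l ⟨hl, hln⟩
    rw [← List.append_assoc z (l ++ z)]
    refine hN₀ l hl (hln ▸ hn) (z ++ (l ++ z)) (isLoop_append_self z l).prepend_self ?_ ?_ _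
      (by rw [hln]; exact hR)
    · rw [loopCount, ← List.append_assoc z z]
      refine (norm_countVec_append_sub_le (by have := hl.1; omega) (z ++ z) z).trans ?_
      rw [List.length_append, hz]
      push_cast
      linarith
    · rw [List.length_append, List.length_append, hz, abs_le]
      push_cast
      constructor <;> linarith

theorem exists_mul_lt_mul {c d : ℝ} (hd : 0 < d) (hdc : d < c) (m L : ℕ) :
    ∃ s > 0, ∃ N : ℕ, ∀ n ≥ N, d * (2 * m + n + (n / s + 1) * L : ℕ) ≤ c * n := by
  -- The slack (c - d) n is split in half: s pays for d L (n / s), N for the constant d (2m + L).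
  obtain ⟨s, hs⟩ := exists_nat_gt (2 * d * L / (c - d))
  obtain ⟨N, hN⟩ := exists_nat_gt (2 * d * (2 * m + L) / (c - d))
  have hpos : 0 < c - d := sub_pos.2 hdc
  have hs0 : (0 : ℝ) < s := lt_of_le_of_lt (by positivity) hs
  rw [div_lt_iff₀ hpos] at hs hN
  refine ⟨s, by exact_mod_cast hs0, N, fun n hn => ?_⟩
  have hn' : (N : ℝ) ≤ n := by exact_mod_cast hn
  have h1 : ((n / s : ℕ) : ℝ) * s ≤ n := by exact_mod_cast Nat.div_mul_le_self n s
  have h2 : (N : ℝ) * (c - d) ≤ n * (c - d) := mul_le_mul_of_nonneg_right hn' hpos.le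
  have h3 : 2 * d * L * ((n / s : ℕ) : ℝ) ≤ n * (c - d) := by
    calc _ ≤ s * (c - d) * ((n / s : ℕ) : ℝ) :=
          mul_le_mul_of_nonneg_right hs.le (Nat.cast_nonneg _)
      _ = ((n / s : ℕ) : ℝ) * s * (c - d) := by ring
      _ ≤ _ := mul_le_mul_of_nonneg_right h1 hpos.le
  push_cast
  linarith

theorem lt_log_of_lt {c : ℝ} {n N : ℕ} (hn : 0 < n)
    (h : (c : EReal) < (((1 / (n : ℝ) : ℝ)) : EReal) * elog2 N) :
    N ≠ 0 ∧ c * n < Real.logb 2 N := by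
  have hn' : (0 : ℝ) < n := by exact_mod_cast hn
  rw [elog2] at h
  split_ifs at h with hN
  · rw [EReal.coe_mul_bot_of_pos (by positivity)] at h
    exact absurd h not_lt_bot
  · refine ⟨hN, ?_⟩
    rw [← EReal.coe_mul, EReal.coe_lt_coe_iff, one_div, inv_mul_eq_div, lt_div_iff₀ hn'] at h
    exact h

theorem capacity_admissible_le [Fintype α] {m : ℕ}
    {Γ : Set ((Fin (m + 1) → α) → ℝ)} (hΓ : Γ ⊆ probMeasures α (m + 1))
    (hclosed : IsClosed Γ) (hconvex : Convex ℝ Γ) (hfat : IsFat Γ) :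
    capacity (admissible Γ) ≤ containedCapacity Γ := by
  refine le_of_forall_lt_imp_le_of_dense fun x hx => ?_
  obtain ⟨d, hxd, hd⟩ := EReal.lt_iff_exists_real_btwn.1 hx
  obtain ⟨c, hdc, hc⟩ := EReal.lt_iff_exists_real_btwn.1 hd
  rw [EReal.coe_lt_coe_iff] at hdc
  refine hxd.le.trans ?_
  have hfreq := Filter.frequently_lt_of_lt_limsup (by isBoundedDefault) hc
  rw [Filter.frequently_atTop] at hfreq
  have hlarge : ∀ N : ℕ, ∃ n ≥ N, {ω ∈ admissible Γ | ω.length = n}.Nonempty ∧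
      c * n < Real.logb 2 (Set.ncard {ω ∈ admissible Γ | ω.length = n}) := by
    intro N
    obtain ⟨n, hn, h⟩ := hfreq (N + 1)
    obtain ⟨h0, hlog⟩ := lt_log_of_lt (by omega) h
    exact ⟨n, by omega, Set.nonempty_of_ncard_ne_zero h0, hlog⟩
  have hα : Nonempty α := by
    obtain ⟨n, -, ⟨l, hl, -⟩, -⟩ := hlarge 0
    have : l ≠ [] := by
      rintro rfl
      have := hl.1
      simp at this
    exact ⟨l.head this⟩
  have hne : (Γ ∩ shiftInvariantMeasures α (m + 1)).Nonempty := by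
    obtain ⟨N, hN⟩ := exists_near_shiftInvariant hΓ hclosed one_pos
    obtain ⟨n, hn, ⟨l, hl, rfl⟩, -⟩ := hlarge N
    obtain ⟨ζ, hζ, -⟩ := hN l hl hn
    exact ⟨ζ, hζ⟩
  obtain ⟨L, hL⟩ := exists_log_ncard_div_le hΓ hclosed hconvex hfat hne
  rcases le_or_gt d 0 with hd0 | hd0
  -- A nonpositive d needs no counting: a single admissible word already gives a nonnegative lower
  -- bound.
  · obtain ⟨N, hN⟩ := hL 1 one_pos
    obtain ⟨n, hn, hT, -⟩ := hlarge N
    refine le_trans (EReal.coe_le_coe_iff.2 (hd0.trans ?_)) (hN n hn hT)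
    refine div_nonneg (Real.logb_nonneg one_lt_two ?_) (Nat.cast_nonneg _)
    exact_mod_cast (Set.ncard_pos (finite_words_of_length _ n)).2 hT
  · obtain ⟨s, hs, N₁, hN₁⟩ := exists_mul_lt_mul hd0 hdc m L
    obtain ⟨N₂, hN₂⟩ := hL s hs
    obtain ⟨n, hn, hT, hlog⟩ := hlarge (max (max N₁ N₂) 1)
    have hn1 : N₁ ≤ n := ((le_max_left _ _).trans (le_max_left _ _)).trans hn
    have hn2 : N₂ ≤ n := ((le_max_right _ _).trans (le_max_left _ _)).trans hn
    have hn3 : 1 ≤ n := (le_max_right _ _).trans hn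
    refine le_trans (EReal.coe_le_coe_iff.2 ?_) (hN₂ n hn2 hT)
    rw [le_div_iff₀ (by exact_mod_cast (by omega : 0 < 2 * m + n + (n / s + 1) * L))]
    exact (hN₁ n hn1).trans hlog.le

end Capacity

end Semiconstrained

theorem mainTheorem6 {α : Type*} [Fintype α] (k : ℕ) (hk : 1 ≤ k)
    (Γ : Set ((Fin k → α) → ℝ)) (hΓ : Γ ⊆ Semiconstrained.probMeasures α k)
    (hclosed : IsClosed Γ) (hconvex : Convex ℝ Γ) (hfat : Semiconstrained.IsFat Γ) :
    Semiconstrained.containedCapacity Γ =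
      Semiconstrained.capacity (Semiconstrained.admissible Γ) := by
  obtain ⟨m, rfl⟩ := Nat.exists_eq_add_of_le' hk
  exact le_antisymm (Semiconstrained.containedCapacity_le Γ)
    (Semiconstrained.capacity_admissible_le hΓ hclosed hconvex hfat)
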